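/- **Theorem 1.** Let $\Lambda$ be a finite set of spins, each with a $d$-dimensional Hilbert space. An operator is supported on $X\subseteq\Lambda$ if it has the form $o\otimes\mathbb 1$ with $o$ acting on the spins in $X$; for an integer $q>0$, a $q$-local operator is a sum $\sum_{|X|\le q}o_X$ with each $o_X$ supported on $X$. Norms of operators are operator norms. Let $k\ge 1$ and let $$H=\sum_{X\subseteq\Lambda,\ |X|\le k}h_X,\qquad \sum_{X\ni i}\|h_X\|\le g\quad\text{for every } i\in\Lambda,$$ be a $k$-local Hamiltonian with Hermitian $h_X$ supported on $X$ (a scalar term $h_\emptyset$ is allowed). Assume that the smallest eigenvalue of $H$ is $0$ and is simple, let $\Omega$ be the normalized ground state, and let $\delta E>0$ be the smallest nonzero eigenvalue of $H$ (the spectral gap). (1) For every $L\subseteq\Lambda$, every operator $\Gamma_L$ supported on $L$ with $\langle\Omega|\Gamma_L|\Omega\rangle\ne 0$, and every integer $q>0$ there is a $q$-local operator $R$ with $$\|R\,\Gamma_L\Omega-\Omega\|\le\frac{6\|\Gamma_L\|}{|\langle\Omega|\Gamma_L|\Omega\rangle|}\,e^{-2n_0/\xi},\qquad n_0=\lfloor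 q/k\rfloor,\quad \xi=\sqrt{1+\frac{2E_c}{\delta E}},\quad E_c=g|L|+8gk\,n_0 .$$ (2) In particular, unique gapped ground states are locally reversible, uniformly in the system: for all $k\ge1$, $g$ and $\delta>0$ there is a function $f:\mathbb R\to\mathbb R$, decaying at $+\infty$ faster than any power and depending only on $k$, $g$ and $\delta$, such that for every $\Lambda$, $d$, $H$, $\Omega$ as above with $\delta E\ge\delta$, every nonempty $L\subseteq\Lambda$, every $\Gamma_L$ supported on $L$ with $\langle\Omega|\Gamma_L|\Omega\rangle\neq0$ and every integer $q>0$ there is a $q$-local operator $R$ with $$\|R\,\Gamma_L\Omega-\Omega\|\le\frac{\|\Gamma_L\|}{|\langle\Omega|\Gamma_L|\Omega\rangle|}\,f\!\left(\frac{q}{\sqrt{|L|}}\right).$$ -/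

import Mathlib

/-- The Hilbert space `(ℂ^d)^{⊗ Λ}` of spins labelled by `Λ`, each with a `d`-dimensional Hilbert
space, in the product basis: the basis vectors are labelled by the configurations `Λ → Fin d`. -/
abbrev SpinSpace (Λ : Type*) [Fintype Λ] (d : ℕ) : Type _ :=
  EuclideanSpace ℂ (Λ → Fin d)

/-- Operators on the spin system, with the operator norm. -/
abbrev SpinOp (Λ : Type*) [Fintype Λ] (d : ℕ) : Type _ :=
  SpinSpace Λ d →L[ℂ] SpinSpace Λ d

/-- The product basis vector of the configuration `σ`. -/
noncomputable def ket {Λ : Type*} [Fintype Λ] [DecidableEq Λ] {d : ℕ} (σ : Λ → Fin d) :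
    SpinSpace Λ d :=
  EuclideanSpace.single σ 1

/-- `O` is supported on the set `X` of spins: `O = o ⊗ 1` for an operator `o` on the spins of `X`
(with matrix `o` in the product basis) and the identity on the spins outside `X`. -/
def SupportedOn {Λ : Type*} [Fintype Λ] [DecidableEq Λ] {d : ℕ} (X : Finset Λ)
    (O : SpinOp Λ d) : Prop :=
  ∃ o : Matrix (X → Fin d) (X → Fin d) ℂ, ∀ σ τ : Λ → Fin d,
    O (ket τ) σ = if ∀ i, i ∉ X → σ i = τ i then o (fun i => σ i) (fun i => τ i) else 0

/-- A `q`-local operator: a sum of operators, each supported on at most `q` spins. -/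
def IsQLocal {Λ : Type*} [Fintype Λ] [DecidableEq Λ] {d : ℕ} (q : ℕ) (O : SpinOp Λ d) : Prop :=
  ∃ o : Finset Λ → SpinOp Λ d, (∀ X, SupportedOn X (o X)) ∧
    O = ∑ X : Finset Λ with X.card ≤ q, o X

/-- A `k`-local Hamiltonian `∑_{|X| ≤ k} h_X` in which the interactions of each spin have total
norm at most `g`. The (scalar) term of the empty set is allowed; it fixes the zero of energy. -/
structure LocalHamiltonian (Λ : Type*) [Fintype Λ] [DecidableEq Λ] (d k : ℕ) (g : ℝ) where
  /-- the interaction term `h_X` -/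
  term : Finset Λ → SpinOp Λ d
  supported : ∀ X, SupportedOn X (term X)
  selfAdjoint : ∀ X, IsSelfAdjoint (term X)
  term_eq_zero : ∀ X, k < X.card → term X = 0
  sum_norm_le : ∀ i : Λ, ∑ X : Finset Λ with i ∈ X, ‖term X‖ ≤ g

/-- The Hamiltonian `H = ∑ h_X`. -/
noncomputable def LocalHamiltonian.op {Λ : Type*} [Fintype Λ] [DecidableEq Λ] {d k : ℕ} {g : ℝ}
    (H : LocalHamiltonian Λ d k g) : SpinOp Λ d :=
  ∑ X : Finset Λ, H.term X

/-- The energies of `H`. -/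
def energies {Λ : Type*} [Fintype Λ] {d : ℕ} (H : SpinOp Λ d) : Set ℝ :=
  {E : ℝ | Module.End.HasEigenvalue (H : SpinSpace Λ d →ₗ[ℂ] SpinSpace Λ d) (E : ℂ)}

/-- `Ω` is the normalized, unique (up to a phase) ground state of `H`, the ground energy is `0`,
and `δE` is the spectral gap, that is, the next energy. -/
structure IsUniqueGroundState {Λ : Type*} [Fintype Λ] [DecidableEq Λ] {d : ℕ} (H : SpinOp Λ d)
    (Ω : SpinSpace Λ d) (δE : ℝ) : Prop where
  norm_eq_one : ‖Ω‖ = 1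
  ground_energy : IsLeast (energies H) 0
  apply_eq_zero : H Ω = 0
  unique : ∀ ψ : SpinSpace Λ d, H ψ = 0 → ∃ c : ℂ, ψ = c • Ω
  gap : IsLeast {E | E ∈ energies H ∧ 0 < E} δE

/-- `E_c = g |L| + 8 g k n₀`, where `l = |L|`. -/
noncomputable def energyCutoff (g : ℝ) (k l n₀ : ℕ) : ℝ := g * l + 8 * g * k * n₀

/-- `ξ = √(1 + 2 E_c / δE)`. -/
noncomputable def reversalLength (Ec δE : ℝ) : ℝ := √(1 + 2 * Ec / δE)

/-- `ψ` is locally reversible with the function `f`. (For `⟨ψ|Γ|ψ⟩ = 0` the bound reads `+∞`.) -/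
def LocallyReversibleWith {Λ : Type*} [Fintype Λ] [DecidableEq Λ] {d : ℕ} (f : ℝ → ℝ)
    (ψ : SpinSpace Λ d) : Prop :=
  ∀ (L : Finset Λ), L.Nonempty → ∀ (Γ : SpinOp Λ d), SupportedOn L Γ → inner ℂ ψ (Γ ψ) ≠ 0 →
    ∀ q : ℕ, 0 < q → ∃ R : SpinOp Λ d, IsQLocal q R ∧
      ‖R (Γ ψ) - ψ‖ ≤ ‖Γ‖ / ‖inner ℂ ψ (Γ ψ)‖ * f (q / √(L.card : ℝ))

/-- `f` decays faster than any power law. -/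
def DecaysSuperpolynomially (f : ℝ → ℝ) : Prop :=
  Asymptotics.SuperpolynomialDecay Filter.atTop (fun x : ℝ => x) f

/-!
Let `p` be a real polynomial of degree at most `n = q / k` with `p 0 = 1`. Then `p(H)` is
`q`-local, and if `p` is small on the nonzero energies, `p(H) Γ Ω` is close to `⟨Ω|Γ|Ω⟩ Ω`; so
`R = p(H) / ⟨Ω|Γ|Ω⟩` reverses `Γ`. The Chebyshev polynomial of the window `[δE, δE + 2 Ec]`,
normalized at `0`, is at most `2 exp (-2 n / ξ)` there (`exists_filter_polynomial`). Above the
window it grows, and the point of the proof is that `Γ Ω` has exponentially small weight there, so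
that the size of the whole system does not matter.

The suppression of high energies is a bound on `exp (tH) Γ Ω`
(`LocalHamiltonian.norm_exp_apply_le`). Let `K` be the sum of the terms of `H` that do not act on
`L`; it commutes with `Γ`, and `H Ω = 0`, so
`exp (tH) Γ Ω = (exp (tH) exp (-tK)) Γ (exp (tK) exp (-tH)) Ω`. The norm of each factor in
parentheses is controlled by the Hermitian part of its generator, which is `H - K` conjugated with
an imaginary time evolution (`norm_exp_mul_exp_neg_apply_le`). That conjugation is a series of
iterated commutators. By locality the `m`-th commutator of a term `h` is at most
`(2 g k)^m m! ‖h‖` (`LocalHamiltonian.norm_iterate_lie_le`), and the commutators of odd order are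
skew-Hermitian, hence do not contribute to the Hermitian part (`re_inner_exp_conj_le`). So
`‖exp (tH) Γ Ω‖ ≤ ‖Γ‖ exp (2 g |L| t + O(t³))`. The absence of a `t²` term matters: the window
ends at `2 Ec = 2 g |L| + 16 g k n`, and when `n` is much smaller than `|L|`, a correction of
second order would exceed the margin `16 g k n t` at the times `t ~ √(n / |L|)` that are needed
to beat the growth of the Chebyshev polynomial (`exists_imaginary_time`).

For the second part, `n / ξ` is at least a constant times `√x` for `x = q / √|L| > k`
(`sqrt_div_le_div_reversalLength`), so a stretched exponential in `x` bounds the error.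
-/

/-! ### Supports of operators -/

section Support

variable {Λ : Type*} [Fintype Λ] [DecidableEq Λ] {d : ℕ}

theorem eq_sum_ket (v : SpinSpace Λ d) : v = ∑ ρ, v ρ • ket ρ := by
  ext σ
  simp [ket, Pi.single_apply]

theorem SpinOp.ext_ket {A B : SpinOp Λ d} (h : ∀ σ τ, A (ket τ) σ = B (ket τ) σ) : A = B := by
  ext1 v
  rw [eq_sum_ket v, map_sum, map_sum]
  refine Finset.sum_congr rfl fun ρ _ => ?_
  rw [map_smul, map_smul]
  congr 1
  ext σ
  exact h σ ρ

theorem SpinOp.mul_ket (A B : SpinOp Λ d) (σ τ : Λ → Fin d) :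
    (A * B) (ket τ) σ = ∑ ρ, A (ket ρ) σ * B (ket τ) ρ := by
  rw [mul_apply_eq_comp, eq_sum_ket (B (ket τ)), map_sum]
  simp only [WithLp.ofLp_sum, Finset.sum_apply, map_smul, PiLp.smul_apply, smul_eq_mul]
  refine Finset.sum_congr rfl fun ρ _ => ?_
  rw [mul_comm]
  congr 1
  simp [ket]

theorem SupportedOn.zero (X : Finset Λ) : SupportedOn X (0 : SpinOp Λ d) :=
  ⟨0, fun σ τ => by simp⟩

theorem SupportedOn.one (X : Finset Λ) : SupportedOn X (1 : SpinOp Λ d) := by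
  refine ⟨1, fun σ τ => ?_⟩
  have h : σ = τ ↔ (∀ i, i ∉ X → σ i = τ i) ∧
      (fun i : X => σ i) = (fun i : X => τ i) := by
    constructor
    · rintro rfl; simp
    · rintro ⟨h1, h2⟩
      ext i
      by_cases hi : i ∈ X
      · rw [show σ i = τ i from congrFun h2 ⟨i, hi⟩]
      · rw [h1 i hi]
  rw [one_apply_eq_self, ket, PiLp.single_apply, Matrix.one_apply, ← ite_and]
  exact if_congr h rfl rfl

theorem SupportedOn.add {X : Finset Λ} {A B : SpinOp Λ d} (hA : SupportedOn X A)
    (hB : SupportedOn X B) : SupportedOn X (A + B) := by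
  obtain ⟨a, ha⟩ := hA
  obtain ⟨b, hb⟩ := hB
  refine ⟨a + b, fun σ τ => ?_⟩
  rw [add_apply, PiLp.add_apply, ha, hb]
  split_ifs <;> simp

theorem SupportedOn.smul {X : Finset Λ} {A : SpinOp Λ d} (c : ℂ) (hA : SupportedOn X A) :
    SupportedOn X (c • A) := by
  obtain ⟨a, ha⟩ := hA
  refine ⟨c • a, fun σ τ => ?_⟩
  rw [smul_apply, PiLp.smul_apply, ha]
  split_ifs <;> simp

theorem SupportedOn.sub {X : Finset Λ} {A B : SpinOp Λ d} (hA : SupportedOn X A)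
    (hB : SupportedOn X B) : SupportedOn X (A - B) := by
  have h : A - B = A + (-1 : ℂ) • B := by module
  exact h ▸ hA.add (hB.smul (-1))

theorem SupportedOn.mono {X Y : Finset Λ} (hXY : X ⊆ Y) {A : SpinOp Λ d} (hA : SupportedOn X A) :
    SupportedOn Y A := by
  obtain ⟨a, ha⟩ := hA
  refine ⟨fun α β => if ∀ i : Y, (i : Λ) ∉ X → α i = β i then
    a (fun i => α ⟨i, hXY i.2⟩) (fun i => β ⟨i, hXY i.2⟩) else 0, fun σ τ => ?_⟩
  rw [ha, ← ite_and]
  refine if_congr ⟨fun h => ⟨fun i hi => h i (fun hX => hi (hXY hX)), fun i hi => h i hi⟩,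
    fun h i hi => ?_⟩ rfl rfl
  by_cases hY : i ∈ Y
  · exact h.2 ⟨i, hY⟩ hi
  · exact h.1 i hY

theorem SupportedOn.mul_same {X : Finset Λ} {A B : SpinOp Λ d} (hA : SupportedOn X A)
    (hB : SupportedOn X B) : SupportedOn X (A * B) := by
  obtain ⟨a, ha⟩ := hA
  obtain ⟨b, hb⟩ := hB
  refine ⟨a * b, fun σ τ => ?_⟩
  rw [SpinOp.mul_ket]
  split_ifs with h
  · rw [Matrix.mul_apply]
    -- Only the intermediate configurations that agree with `τ` outside `X` contribute.
    have hres : ∀ α : X → Fin d,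
        (fun i : X => (fun j => if hj : j ∈ X then α ⟨j, hj⟩ else τ j : Λ → Fin d) i) = α := by
      intro α; ext i; simp
    symm
    refine Finset.sum_of_injOn
      (fun (α : X → Fin d) (j : Λ) => if hj : j ∈ X then α ⟨j, hj⟩ else τ j) ?_ (by simp) ?_ ?_
    · intro α _ β _ hαβ
      rw [← hres α, ← hres β]
      simp only at hαβ
      rw [hαβ]
    · intro ρ _ hρ
      rw [hb, if_neg, mul_zero]
      intro hρτ
      refine hρ ⟨fun i => ρ i, by simp, ?_⟩
      ext j
      by_cases hj : j ∈ X <;> simp [hj, hρτ]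
    · intro α _
      rw [ha, hb, if_pos, if_pos, hres]
      · intro i hi; simp [hi]
      · intro i hi; simp [hi, h i hi]
  · refine Finset.sum_eq_zero fun ρ _ => ?_
    rw [ha, hb]
    split_ifs with h1 h2 <;> try simp
    exact absurd (fun i hi => (h1 i hi).trans (h2 i hi)) h

theorem SupportedOn.mul {X Y : Finset Λ} {A B : SpinOp Λ d} (hA : SupportedOn X A)
    (hB : SupportedOn Y B) : SupportedOn (X ∪ Y) (A * B) :=
  (hA.mono Finset.subset_union_left).mul_same (hB.mono Finset.subset_union_right)

/-- Matrix elements of a product of operators with disjoint supports: a single intermediate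
configuration contributes. -/
theorem SupportedOn.mul_ket_of_disjoint {X Y : Finset Λ} (hXY : Disjoint X Y) {A B : SpinOp Λ d}
    {a : Matrix (X → Fin d) (X → Fin d) ℂ} {b : Matrix (Y → Fin d) (Y → Fin d) ℂ}
    (ha : ∀ σ τ : Λ → Fin d,
      A (ket τ) σ = if ∀ i, i ∉ X → σ i = τ i then a (fun i => σ i) (fun i => τ i) else 0)
    (hb : ∀ σ τ : Λ → Fin d,
      B (ket τ) σ = if ∀ i, i ∉ Y → σ i = τ i then b (fun i => σ i) (fun i => τ i) else 0)
    (σ τ : Λ → Fin d) :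
    (A * B) (ket τ) σ = if ∀ i, i ∉ X → i ∉ Y → σ i = τ i then
      a (fun i => σ i) (fun i => τ i) * b (fun i => σ i) (fun i => τ i) else 0 := by
  rw [SpinOp.mul_ket, Finset.sum_eq_single (X.piecewise τ σ)]
  · rw [ha, hb, if_pos (fun i hi => by simp [hi])]
    have h1 : (fun i : X => X.piecewise τ σ (i : Λ)) = fun i : X => τ i := by
      ext i; simp
    have h2 : (fun i : Y => X.piecewise τ σ (i : Λ)) = fun i : Y => σ i := by
      ext i; simp [Finset.disjoint_right.1 hXY i.2]
    rw [h1, h2, mul_ite, mul_zero]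
    refine if_congr ⟨fun h i hX hY => ?_, fun h i hY => ?_⟩ rfl rfl
    · simpa [hX] using h i hY
    · by_cases hX : i ∈ X
      · simp [hX]
      · simpa [hX] using h i hX hY
  · intro ρ _ hρ
    rw [ha, hb]
    split_ifs with h1 h2 <;> try simp
    refine absurd ?_ hρ
    ext i
    by_cases hX : i ∈ X
    · simp [hX, h2 i (Finset.disjoint_left.1 hXY hX)]
    · simp [hX, h1 i hX]
  · simp

theorem SupportedOn.mul_comm_of_disjoint {X Y : Finset Λ} (hXY : Disjoint X Y) {A B : SpinOp Λ d}
    (hA : SupportedOn X A) (hB : SupportedOn Y B) : A * B = B * A := by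
  obtain ⟨a, ha⟩ := hA
  obtain ⟨b, hb⟩ := hB
  refine SpinOp.ext_ket fun σ τ => ?_
  rw [SupportedOn.mul_ket_of_disjoint hXY ha hb, SupportedOn.mul_ket_of_disjoint hXY.symm hb ha,
    mul_comm (a _ _)]
  exact if_congr ⟨fun h i h1 h2 => h i h2 h1, fun h i h1 h2 => h i h2 h1⟩ rfl rfl

/-- An operator supported on no spin is a scalar. -/
theorem SupportedOn.exists_eq_smul_one {A : SpinOp Λ d} (hA : SupportedOn ∅ A) :
    ∃ c : ℂ, A = c • 1 := by
  obtain ⟨a, ha⟩ := hA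
  refine ⟨a isEmptyElim isEmptyElim, SpinOp.ext_ket fun σ τ => ?_⟩
  rw [ha, smul_apply, PiLp.smul_apply, one_apply_eq_self, ket,
    PiLp.single_apply, smul_eq_mul, mul_ite, mul_one, mul_zero]
  refine if_congr (by simp [funext_iff]) ?_ rfl
  congr 1 <;> exact Subsingleton.elim _ _

end Support

/-! ### `q`-local operators -/

section QLocal

variable {Λ : Type*} [Fintype Λ] [DecidableEq Λ] {d : ℕ}

theorem IsQLocal.zero (q : ℕ) : IsQLocal q (0 : SpinOp Λ d) :=
  ⟨0, fun X => SupportedOn.zero X, by simp⟩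

theorem IsQLocal.add {q : ℕ} {A B : SpinOp Λ d} (hA : IsQLocal q A) (hB : IsQLocal q B) :
    IsQLocal q (A + B) := by
  obtain ⟨a, ha, rfl⟩ := hA
  obtain ⟨b, hb, rfl⟩ := hB
  exact ⟨a + b, fun X => (ha X).add (hb X), by simp [Finset.sum_add_distrib]⟩

theorem IsQLocal.smul {q : ℕ} {A : SpinOp Λ d} (c : ℂ) (hA : IsQLocal q A) :
    IsQLocal q (c • A) := by
  obtain ⟨a, ha, rfl⟩ := hA
  exact ⟨c • a, fun X => (ha X).smul c, by simp [Finset.smul_sum]⟩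

theorem IsQLocal.sum {q : ℕ} {ι : Type*} (s : Finset ι) {A : ι → SpinOp Λ d}
    (hA : ∀ i ∈ s, IsQLocal q (A i)) : IsQLocal q (∑ i ∈ s, A i) :=
  Finset.sum_induction A (IsQLocal q) (fun _ _ => IsQLocal.add) (IsQLocal.zero q) hA

theorem SupportedOn.isQLocal {q : ℕ} {X : Finset Λ} (hX : X.card ≤ q) {A : SpinOp Λ d}
    (hA : SupportedOn X A) : IsQLocal q A := by
  refine ⟨fun Y => if Y = X then A else 0, fun Y => ?_, ?_⟩
  · dsimp only
    split_ifs with h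
    · exact h ▸ hA
    · exact SupportedOn.zero Y
  · simp [Finset.sum_ite_eq', hX]

theorem IsQLocal.mono {p q : ℕ} (hpq : p ≤ q) {A : SpinOp Λ d} (hA : IsQLocal p A) :
    IsQLocal q A := by
  obtain ⟨a, ha, rfl⟩ := hA
  exact IsQLocal.sum _ fun X hX => (ha X).isQLocal ((Finset.mem_filter.1 hX).2.trans hpq)

theorem IsQLocal.mul {p q : ℕ} {A B : SpinOp Λ d} (hA : IsQLocal p A) (hB : IsQLocal q B) :
    IsQLocal (p + q) (A * B) := by
  obtain ⟨a, ha, rfl⟩ := hA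
  obtain ⟨b, hb, rfl⟩ := hB
  rw [Finset.sum_mul_sum]
  refine IsQLocal.sum _ fun X hX => IsQLocal.sum _ fun Y hY => ?_
  exact ((ha X).mul (hb Y)).isQLocal ((Finset.card_union_le X Y).trans
    (add_le_add (Finset.mem_filter.1 hX).2 (Finset.mem_filter.1 hY).2))

theorem IsQLocal.pow {k : ℕ} {A : SpinOp Λ d} (hA : IsQLocal k A) (n : ℕ) :
    IsQLocal (n * k) (A ^ n) := by
  induction n with
  | zero => exact (SupportedOn.one ∅).isQLocal (by simp)
  | succ n ih => rw [pow_succ, Nat.succ_mul]; exact ih.mul hA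

theorem IsQLocal.aeval {k n : ℕ} {A : SpinOp Λ d} (hA : IsQLocal k A) (p : Polynomial ℂ)
    (hp : p.natDegree ≤ n) : IsQLocal (n * k) (Polynomial.aeval A p) := by
  rw [Polynomial.aeval_eq_sum_range]
  refine IsQLocal.sum _ fun i hi => ((hA.pow i).smul _).mono ?_
  have := Finset.mem_range.1 hi
  exact Nat.mul_le_mul_right k (by omega)

theorem LocalHamiltonian.isQLocal_op {k : ℕ} {g : ℝ} (H : LocalHamiltonian Λ d k g) :
    IsQLocal k H.op := by
  refine IsQLocal.sum _ fun X _ => ?_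
  by_cases hX : X.card ≤ k
  · exact (H.supported X).isQLocal hX
  · rw [H.term_eq_zero X (not_le.1 hX)]; exact IsQLocal.zero k

end QLocal

/-! ### Conjugation by exponentials -/

section ImaginaryTime

open NormedSpace

/-- The exponential series of an operator, evaluated at a vector. -/
theorem hasSum_exp_apply {E : Type*} [NormedAddCommGroup E] [NormedSpace ℂ E] [CompleteSpace E]
    (T : E →L[ℂ] E) (x : E) :
    HasSum (fun m : ℕ => ((m.factorial : ℂ)⁻¹) • (T ^ m) x) (exp T x) := by
  have h := (exp_series_hasSum_exp' (𝕂 := ℂ) T).mapL (ContinuousLinearMap.apply ℂ E x)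
  simpa using h

section Algebra

variable {𝔸 : Type*} [NormedRing 𝔸] [NormedAlgebra ℂ 𝔸] [CompleteSpace 𝔸]

/-- `exp H * B * exp (-H)` is the exponential of the derivation `B ↦ H * B - B * H`, applied
to `B`. -/
theorem hasSum_exp_mul_mul_exp_neg (H B : 𝔸) :
    HasSum (fun m : ℕ => ((m.factorial : ℂ)⁻¹) • (fun C : 𝔸 => ⁅H, C⁆)^[m] B)
      (exp H * B * exp (-H)) := by
  -- The derivation is the difference of left and right multiplication by `H`, which commute.
  set l := ContinuousLinearMap.mul ℂ 𝔸 H with hl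
  set r := (ContinuousLinearMap.mul ℂ 𝔸).flip (-H) with hr
  have hcomm : Commute l r := by
    ext C
    simp [hl, hr, mul_assoc]
  have hL : ∀ C, exp l C = exp H * C := by
    intro C
    refine (hasSum_exp_apply l C).unique ?_
    have h := (exp_series_hasSum_exp' (𝕂 := ℂ) H).mul_right C
    have : ∀ m, (l ^ m) C = H ^ m * C := by
      intro m
      induction m with
      | zero => simp
      | succ m ih => rw [pow_succ', mul_apply_eq_comp, ih, hl, pow_succ']; simp [mul_assoc]
    simpa only [this, smul_mul_assoc] using h
  have hR : ∀ C, exp r C = C * exp (-H) := by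
    intro C
    refine (hasSum_exp_apply r C).unique ?_
    have h := (exp_series_hasSum_exp' (𝕂 := ℂ) (-H)).mul_left C
    have : ∀ m, (r ^ m) C = C * (-H) ^ m := by
      intro m
      induction m with
      | zero => simp
      | succ m ih =>
        rw [pow_succ', mul_apply_eq_comp, ih, hr, pow_succ, ContinuousLinearMap.flip_apply,
          ContinuousLinearMap.mul_apply', mul_assoc]
    simpa only [this, mul_smul_comm] using h
  let _ : NormedAlgebra ℚ (𝔸 →L[ℂ] 𝔸) := NormedAlgebra.restrictScalars ℚ ℂ _
  have h := hasSum_exp_apply (l + r) B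
  rw [exp_add_of_commute hcomm, mul_apply_eq_comp, hR, hL, ← mul_assoc] at h
  have hpow : ∀ m, (fun C : 𝔸 => ⁅H, C⁆)^[m] B = ((l + r) ^ m) B := by
    intro m
    induction m with
    | zero => simp
    | succ m ih =>
      rw [Function.iterate_succ_apply', ih, pow_succ', mul_apply_eq_comp, Ring.lie_def, add_apply,
        hl, hr, ContinuousLinearMap.flip_apply, ContinuousLinearMap.mul_apply',
        ContinuousLinearMap.mul_apply', mul_neg, sub_eq_add_neg]
  simpa only [hpow] using h

theorem exp_neg_mul_exp (H : 𝔸) : exp (-H) * exp H = 1 := by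
  let _ : NormedAlgebra ℚ 𝔸 := NormedAlgebra.restrictScalars ℚ ℂ _
  rw [← exp_add_of_commute ((Commute.refl _).neg_left), neg_add_cancel, exp_zero]

end Algebra

theorem iterate_lie_smul {𝔸 : Type*} [NormedRing 𝔸] [NormedAlgebra ℂ 𝔸] (t : ℂ) (H B : 𝔸) (m : ℕ) :
    (fun C : 𝔸 => ⁅t • H, C⁆)^[m] B = t ^ m • (fun C : 𝔸 => ⁅H, C⁆)^[m] B := by
  induction m with
  | zero => simp
  | succ m ih =>
    rw [Function.iterate_succ_apply', ih, Function.iterate_succ_apply', Ring.lie_def,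
      Ring.lie_def, smul_mul_assoc, mul_smul_comm, smul_mul_assoc, mul_smul_comm, smul_sub,
      pow_succ, mul_smul, mul_smul, smul_comm t]

theorem iterate_lie_sum {𝔸 ι : Type*} [Ring 𝔸] (H : 𝔸) (s : Finset ι) (f : ι → 𝔸) (m : ℕ) :
    (fun C : 𝔸 => ⁅H, C⁆)^[m] (∑ i ∈ s, f i) = ∑ i ∈ s, (fun C : 𝔸 => ⁅H, C⁆)^[m] (f i) := by
  induction m with
  | zero => simp
  | succ m ih =>
    simp only [Function.iterate_succ_apply', ih]
    simp only [Ring.lie_def, Finset.mul_sum, Finset.sum_mul, Finset.sum_sub_distrib]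

theorem iterate_lie_zero {𝔸 : Type*} [Ring 𝔸] (H : 𝔸) (m : ℕ) :
    (fun C : 𝔸 => ⁅H, C⁆)^[m] 0 = 0 :=
  Function.iterate_fixed (by simp [Ring.lie_def]) m

variable {E : Type*} [NormedAddCommGroup E] [InnerProductSpace ℂ E] [CompleteSpace E]

theorem star_iterate_lie {H B : E →L[ℂ] E} (hH : IsSelfAdjoint H) (hB : IsSelfAdjoint B) (m : ℕ) :
    star ((fun C : E →L[ℂ] E => ⁅H, C⁆)^[m] B)
      = (-1 : ℂ) ^ m • (fun C : E →L[ℂ] E => ⁅H, C⁆)^[m] B := by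
  induction m with
  | zero => simpa using hB.star_eq
  | succ m ih =>
    rw [Function.iterate_succ_apply', Ring.lie_def, star_sub, star_mul, star_mul, hH.star_eq, ih,
      pow_succ, mul_smul, neg_one_smul]
    simp only [smul_mul_assoc, mul_smul_comm, smul_sub, smul_neg]
    abel

/-- The quadratic form of a skew-adjoint operator is purely imaginary. -/
theorem re_inner_apply_eq_zero_of_star_eq_neg {B : E →L[ℂ] E} (hB : star B = -B) (x : E) :
    (inner ℂ x (B x)).re = 0 := by
  have h : inner ℂ x (B x) = -inner ℂ (B x) x := by
    rw [← ContinuousLinearMap.adjoint_inner_right, ← ContinuousLinearMap.star_eq_adjoint, hB,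
      neg_apply, inner_neg_right, neg_neg]
  have h2 : (inner ℂ (B x) x).re = (inner ℂ x (B x)).re := inner_re_symm (𝕜 := ℂ) _ _
  have h3 := congrArg Complex.re h
  rw [Complex.neg_re, h2] at h3
  linarith

/-- If the iterated commutators of `H` with `B` grow at most like `b ^ m * m!`, then the real part
of the quadratic form of `exp (tH) B exp (-tH)` exceeds `‖B‖` only at second order in `t`: the
commutators of odd order are skew-adjoint and do not contribute. -/
theorem re_inner_exp_conj_le {H B : E →L[ℂ] E} (hH : IsSelfAdjoint H) (hB : IsSelfAdjoint B)
    {b c : ℝ} (hbound : ∀ m : ℕ, ‖(fun C : E →L[ℂ] E => ⁅H, C⁆)^[m] B‖ ≤ c * b ^ m * m.factorial)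
    {t : ℝ} (hv : |b * t| < 1) (x : E) :
    |(inner ℂ x ((exp ((t : ℂ) • H) * B * exp (-((t : ℂ) • H))) x)).re|
      ≤ c * ‖x‖ ^ 2 / (1 - (b * t) ^ 2) := by
  have h0 := (hasSum_exp_mul_mul_exp_neg ((t : ℂ) • H) B).mapL (ContinuousLinearMap.apply ℂ E x)
  have h1 := Complex.hasSum_re (h0.mapL (innerSL ℂ x))
  have hgeo := ((hasSum_geometric_of_abs_lt_one hv).add
    (hasSum_geometric_of_abs_lt_one (r := -(b * t)) (by rwa [abs_neg]))).mul_left (c * ‖x‖ ^ 2 / 2)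
  have hne : (1 - b * t) ≠ 0 := by have := abs_lt.1 hv; linarith
  have hne' : (1 + b * t) ≠ 0 := by have := abs_lt.1 hv; linarith
  have hval : c * ‖x‖ ^ 2 / 2 * ((1 - b * t)⁻¹ + (1 - -(b * t))⁻¹)
      = c * ‖x‖ ^ 2 / (1 - (b * t) ^ 2) := by
    rw [show (1 - (b * t) ^ 2) = (1 - b * t) * (1 + b * t) by ring, sub_neg_eq_add]
    field_simp
    ring
  rw [hval] at hgeo
  have hterm : ∀ m : ℕ,
      |((innerSL ℂ x) ((ContinuousLinearMap.apply ℂ E x)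
        (((m.factorial : ℂ)⁻¹) • (fun C : E →L[ℂ] E => ⁅(t : ℂ) • H, C⁆)^[m] B))).re|
      ≤ c * ‖x‖ ^ 2 / 2 * ((b * t) ^ m + (-(b * t)) ^ m) := by
    intro m
    rw [iterate_lie_smul, smul_smul]
    have hcast : ((m.factorial : ℂ)⁻¹ * (t : ℂ) ^ m) = (((m.factorial : ℝ)⁻¹ * t ^ m : ℝ) : ℂ) := by
      push_cast; rfl
    rw [hcast, map_smul, map_smul, smul_eq_mul, Complex.re_ofReal_mul]
    rcases Nat.even_or_odd m with hm | hm
    · rw [hm.neg_pow, abs_mul]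
      have hin : |((innerSL ℂ x) ((ContinuousLinearMap.apply ℂ E x)
          ((fun C : E →L[ℂ] E => ⁅H, C⁆)^[m] B))).re| ≤ c * b ^ m * m.factorial * ‖x‖ ^ 2 := by
        refine (Complex.abs_re_le_norm _).trans ?_
        refine (norm_inner_le_norm (𝕜 := ℂ) x _).trans ?_
        calc ‖x‖ * ‖((fun C : E →L[ℂ] E => ⁅H, C⁆)^[m] B) x‖
            ≤ ‖x‖ * (c * b ^ m * m.factorial * ‖x‖) := by
              gcongr
              exact ContinuousLinearMap.le_of_opNorm_le _ (hbound m) x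
          _ = _ := by ring
      have hpos : (0 : ℝ) < m.factorial := by exact_mod_cast m.factorial_pos
      rw [abs_of_nonneg (mul_nonneg (inv_nonneg.2 hpos.le) (hm.pow_nonneg t))]
      refine (mul_le_mul_of_nonneg_left hin
        (mul_nonneg (inv_nonneg.2 hpos.le) (hm.pow_nonneg t))).trans (le_of_eq ?_)
      rw [mul_pow]
      field_simp
      ring
    · have hskew := star_iterate_lie hH hB m
      rw [hm.neg_one_pow, neg_one_smul] at hskew
      have := re_inner_apply_eq_zero_of_star_eq_neg hskew x
      rw [show ((innerSL ℂ x) ((ContinuousLinearMap.apply ℂ E x)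
          ((fun C : E →L[ℂ] E => ⁅H, C⁆)^[m] B))).re = 0 from this, hm.neg_pow]
      simp
  refine abs_le.2 ⟨?_, hasSum_le (fun m => (abs_le.1 (hterm m)).2) h1 hgeo⟩
  exact hasSum_le (fun m => (abs_le.1 (hterm m)).1) hgeo.neg h1

/-- Growth of `exp (tH) exp (-tK)` in terms of the real part of its generator
`exp (tH) (H - K) exp (-tH)`. -/
theorem norm_exp_mul_exp_neg_apply_le {H K : E →L[ℂ] E} {T : ℝ} (hT : 0 ≤ T) {α α' : ℝ → ℝ}
    (hα : ∀ t, HasDerivAt α (α' t) t) (hα0 : α 0 = 0)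
    (hbound : ∀ t ∈ Set.Icc 0 T, ∀ x : E,
      (inner ℂ x ((exp ((t : ℂ) • H) * (H - K) * exp (-((t : ℂ) • H))) x)).re ≤ α' t * ‖x‖ ^ 2)
    (x : E) :
    ‖exp ((T : ℂ) • H) (exp (-((T : ℂ) • K)) x)‖ ≤ Real.exp (α T) * ‖x‖ := by
  set φ : ℝ → E := fun t => (exp ((t : ℂ) • H) * exp (-((t : ℂ) • K))) x with hφ
  have hder : ∀ t : ℝ, HasDerivAt φ
      ((exp ((t : ℂ) • H) * (H - K) * exp (-((t : ℂ) • H))) (φ t)) t := by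
    intro t
    have h1 : HasDerivAt (fun t : ℝ => exp ((t : ℂ) • H)) (exp ((t : ℂ) • H) * H) t := by
      simpa [Function.comp_def] using HasDerivAt.scomp t
        (hasDerivAt_exp_smul_const (𝕂 := ℂ) H (t : ℂ)) Complex.ofRealCLM.hasDerivAt
    have h2 : HasDerivAt (fun t : ℝ => exp (-((t : ℂ) • K))) (-K * exp (-((t : ℂ) • K))) t := by
      simpa [Function.comp_def] using HasDerivAt.scomp t
        (hasDerivAt_exp_smul_const' (𝕂 := ℂ) (-K) (t : ℂ)) Complex.ofRealCLM.hasDerivAt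
    have h3 := ((ContinuousLinearMap.apply ℂ E x).restrictScalars ℝ).hasFDerivAt.comp_hasDerivAt t
      (h1.mul h2)
    refine h3.congr_deriv ?_
    symm
    simp only [hφ, ContinuousLinearMap.coe_restrictScalars', ContinuousLinearMap.apply_apply]
    rw [← mul_apply_eq_comp]
    congr 1
    rw [mul_assoc, ← mul_assoc (exp (-((t : ℂ) • H))), exp_neg_mul_exp, one_mul]
    noncomm_ring
  set N : ℝ → ℝ := fun t => Real.exp (-2 * α t) * ‖φ t‖ ^ 2 with hN
  have hNder : ∀ t : ℝ, HasDerivAt N (Real.exp (-2 * α t) * (-2 * α' t) * ‖φ t‖ ^ 2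
      + Real.exp (-2 * α t) * (2 * (inner ℂ (φ t)
        ((exp ((t : ℂ) • H) * (H - K) * exp (-((t : ℂ) • H))) (φ t))).re)) t := by
    intro t
    have h2 : HasDerivAt (fun t => ‖φ t‖ ^ 2) (2 * (inner ℂ (φ t)
        ((exp ((t : ℂ) • H) * (H - K) * exp (-((t : ℂ) • H))) (φ t))).re) t := by
      have h3 := Complex.reCLM.hasFDerivAt.comp_hasDerivAt t ((hder t).inner ℂ (hder t))
      have h4 : (fun t => ‖φ t‖ ^ 2) = Complex.reCLM ∘ fun t => inner ℂ (φ t) (φ t) :=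
        funext fun s => norm_sq_eq_re_inner (𝕜 := ℂ) (φ s)
      rw [h4]
      refine h3.congr_deriv ?_
      rw [map_add, Complex.reCLM_apply, Complex.reCLM_apply, two_mul]
      congr 1
      exact inner_re_symm (𝕜 := ℂ) _ _
    exact ((hα t).const_mul (-2)).exp.mul h2
  have hanti : AntitoneOn N (Set.Icc 0 T) := by
    refine antitoneOn_of_deriv_nonpos (convex_Icc 0 T)
      (fun t _ => (hNder t).continuousAt.continuousWithinAt)
      (fun t _ => (hNder t).differentiableAt.differentiableWithinAt) fun t ht => ?_
    rw [(hNder t).deriv]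
    have hb := hbound t (interior_subset ht) (φ t)
    have he := Real.exp_pos (-2 * α t)
    nlinarith
  have hfin := hanti (Set.left_mem_Icc.2 hT) (Set.right_mem_Icc.2 hT) hT
  have hφ0 : φ 0 = x := by simp [hφ]
  simp only [hN, hα0, mul_zero, Real.exp_zero, one_mul, hφ0] at hfin
  have hfin2 : ‖φ T‖ ^ 2 ≤ (Real.exp (α T) * ‖x‖) ^ 2 := by
    have h4 : Real.exp (α T) ^ 2 * Real.exp (-2 * α T) = 1 := by
      rw [← Real.exp_nat_mul, ← Real.exp_add]
      simp
    calc ‖φ T‖ ^ 2 = Real.exp (α T) ^ 2 * (Real.exp (-2 * α T) * ‖φ T‖ ^ 2) := by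
          rw [← mul_assoc, h4, one_mul]
      _ ≤ Real.exp (α T) ^ 2 * ‖x‖ ^ 2 := by gcongr
      _ = _ := by ring
  exact le_of_sq_le_sq hfin2 (by positivity)

end ImaginaryTime

/-! ### Chebyshev polynomials outside the unit interval -/

section Chebyshev

open Polynomial

theorem sinh_le_mul_cosh {z : ℝ} (hz : 0 ≤ z) : Real.sinh z ≤ z * Real.cosh z := by
  have hder : ∀ x : ℝ, HasDerivAt (fun x => x * Real.cosh x - Real.sinh x) (x * Real.sinh x) x := by
    intro x
    have h := ((hasDerivAt_id x).mul (Real.hasDerivAt_cosh x)).sub (Real.hasDerivAt_sinh x)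
    refine h.congr_deriv ?_
    simp
  have hmono : MonotoneOn (fun x => x * Real.cosh x - Real.sinh x) (Set.Ici 0) := by
    refine monotoneOn_of_deriv_nonneg (convex_Ici 0)
      (fun x _ => (hder x).continuousAt.continuousWithinAt)
      (fun x _ => (hder x).differentiableAt.differentiableWithinAt) fun x hx => ?_
    rw [(hder x).deriv]
    rw [interior_Ici] at hx
    exact mul_nonneg hx.le (Real.sinh_nonneg_iff.2 hx.le)
  have := hmono Set.self_mem_Ici hz hz
  simp only [Real.cosh_zero, Real.sinh_zero, zero_mul, sub_zero] at this
  linarith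

/-- In terms of `y = 1 + 2 z² / (1 - z²)`, the bound `2 z ≤ arcosh y`; it amounts to
`tanh z ≤ z`. -/
theorem cosh_two_mul_le {z : ℝ} (hz : 0 ≤ z) (hz1 : z < 1) :
    Real.cosh (2 * z) ≤ 1 + 2 * z ^ 2 / (1 - z ^ 2) := by
  have h1 := sinh_le_mul_cosh hz
  have h2 := Real.cosh_sq z
  have h3 := Real.sinh_nonneg_iff.2 hz
  have h4 : 0 < 1 - z ^ 2 := by nlinarith
  have h5 : Real.sinh z ^ 2 ≤ z ^ 2 * Real.cosh z ^ 2 := by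
    rw [← mul_pow]; gcongr
  rw [Real.cosh_two_mul, h2, ← sub_le_iff_le_add', le_div_iff₀ h4]
  rw [h2] at h5
  linarith

/-- Growth of `T_n` outside the unit interval, from below. -/
theorem exp_le_two_mul_eval_T (n : ℕ) {z : ℝ} (hz : 0 ≤ z) (hz1 : z < 1) :
    Real.exp (2 * n * z) ≤ 2 * (Chebyshev.T ℝ n).eval (1 + 2 * z ^ 2 / (1 - z ^ 2)) := by
  have hy := cosh_two_mul_le hz hz1
  set y := 1 + 2 * z ^ 2 / (1 - z ^ 2)
  have hy1 : 1 ≤ y := (Real.one_le_cosh _).trans hy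
  have hθ : 2 * z ≤ Real.arcosh y := by
    rw [← Real.cosh_arcosh hy1, Real.cosh_le_cosh, abs_of_nonneg (by positivity),
      abs_of_nonneg (Real.arcosh_nonneg hy1)] at hy
    exact hy
  rw [← Real.cosh_arcosh hy1, Chebyshev.T_real_cosh, Real.cosh_eq]
  have h1 : Real.exp (2 * n * z) ≤ Real.exp ((n : ℤ) * Real.arcosh y) := by
    rw [Real.exp_le_exp]
    push_cast
    nlinarith [Nat.cast_nonneg (α := ℝ) n]
  have h2 := Real.exp_pos (-((n : ℤ) * Real.arcosh y))
  linarith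

/-- Growth of `T_n` outside the unit interval, from above: subexponential in `s`, since
`T_n (1 + s)` is about `exp (n √(2 s))`. The parameter `B` is free. -/
theorem abs_eval_T_one_add_le (n : ℕ) {s B : ℝ} (hs : 0 ≤ s) (hB : 0 < B) :
    |(Chebyshev.T ℝ n).eval (1 + s)| ≤ Real.exp (B * s + n ^ 2 / (2 * B)) := by
  have hy1 : 1 ≤ 1 + s := by linarith
  have hθ0 := Real.arcosh_nonneg hy1
  have hcosh := Real.cosh_arcosh hy1
  have hquad : Real.arcosh (1 + s) ^ 2 / 2 ≤ s := by
    have h1 : Real.cosh (Real.arcosh (1 + s)) = 1 + 2 * Real.sinh (Real.arcosh (1 + s) / 2) ^ 2 := by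
      have := Real.cosh_two_mul (Real.arcosh (1 + s) / 2)
      rw [mul_div_cancel₀ _ two_ne_zero, Real.cosh_sq] at this
      linarith
    have h2 : Real.arcosh (1 + s) / 2 ≤ Real.sinh (Real.arcosh (1 + s) / 2) :=
      Real.self_le_sinh_iff.2 (by positivity)
    have h3 : (Real.arcosh (1 + s) / 2) ^ 2 ≤ Real.sinh (Real.arcosh (1 + s) / 2) ^ 2 := by
      gcongr
    nlinarith
  have hT : (Chebyshev.T ℝ n).eval (1 + s) = Real.cosh ((n : ℤ) * Real.arcosh (1 + s)) := by
    rw [← Chebyshev.T_real_cosh, hcosh]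
  rw [hT, abs_of_pos (Real.cosh_pos _)]
  have h4 : Real.cosh ((n : ℤ) * Real.arcosh (1 + s)) ≤ Real.exp (n * Real.arcosh (1 + s)) := by
    have h5 : (0 : ℝ) ≤ n * Real.arcosh (1 + s) := by positivity
    rw [Real.cosh_eq, Int.cast_natCast]
    have : Real.exp (-(n * Real.arcosh (1 + s))) ≤ Real.exp (n * Real.arcosh (1 + s)) :=
      Real.exp_le_exp.2 (by linarith)
    linarith
  refine h4.trans (Real.exp_le_exp.2 ?_)
  -- Young's inequality `n θ ≤ B θ² / 2 + n² / (2 B)`.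
  have h6 : (n : ℝ) * Real.arcosh (1 + s)
      ≤ B * (Real.arcosh (1 + s) ^ 2 / 2) + n ^ 2 / (2 * B) := by
    have h7 : B * (Real.arcosh (1 + s) ^ 2 / 2) + n ^ 2 / (2 * B) - n * Real.arcosh (1 + s)
        = (B * Real.arcosh (1 + s) - n) ^ 2 / (2 * B) := by
      field_simp
      ring
    have h8 : 0 ≤ (B * Real.arcosh (1 + s) - n) ^ 2 / (2 * B) := by positivity
    linarith
  have h9 := mul_le_mul_of_nonneg_left hquad hB.le
  linarith

/-- A polynomial of degree `n` that is `1` at the ground energy and exponentially small on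
`[δE, δE + 2 Ec]`, with control of its growth above that window: the Chebyshev polynomial of the
window, normalized at `0`. -/
theorem exists_filter_polynomial (n : ℕ) {Ec δE : ℝ} (hEc : 0 < Ec) (hδ : 0 < δE) :
    ∃ p : ℝ[X], p.natDegree ≤ n ∧ p.eval 0 = 1 ∧
      (∀ x, δE ≤ x → x ≤ δE + 2 * Ec →
        |p.eval x| ≤ 2 * Real.exp (-2 * n / reversalLength Ec δE)) ∧
      ∀ x, δE + 2 * Ec ≤ x → ∀ B, 0 < B →
        |p.eval x| ≤ 2 * Real.exp (-2 * n / reversalLength Ec δE) *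
          Real.exp (B * ((x - δE - 2 * Ec) / Ec) + n ^ 2 / (2 * B)) := by
  set ξ := reversalLength Ec δE with hξ
  have hξ2 : ξ ^ 2 = 1 + 2 * Ec / δE := Real.sq_sqrt (by positivity)
  have hξ1 : 1 < ξ := by
    have h1 : (0 : ℝ) < 2 * Ec / δE := by positivity
    exact Real.lt_sqrt_of_sq_lt (by linarith)
  have hξ0 : 0 < ξ := by linarith
  -- The window is mapped to `[-1, 1]` in such a way that `0` goes to `1 + δE / Ec`.
  have hy : 1 + 2 * (1 / ξ) ^ 2 / (1 - (1 / ξ) ^ 2) = 1 + δE / Ec := by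
    have h2 : (1 / ξ) ^ 2 = δE / (δE + 2 * Ec) := by
      rw [one_div, inv_pow, hξ2]
      field_simp
    have h3 : 1 - δE / (δE + 2 * Ec) = 2 * Ec / (δE + 2 * Ec) := by
      field_simp
      ring
    rw [h2, h3]
    field_simp
  have hT := exp_le_two_mul_eval_T n (z := 1 / ξ) (by positivity)
    (by rw [div_lt_one hξ0]; exact hξ1)
  rw [hy] at hT
  set t₀ := (Chebyshev.T ℝ n).eval (1 + δE / Ec)
  have ht₀ : 0 < t₀ := by
    have := Real.exp_pos (2 * n * (1 / ξ))
    linarith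
  have hinv : t₀⁻¹ ≤ 2 * Real.exp (-2 * n / ξ) := by
    have h4 : Real.exp (-2 * n / ξ) * Real.exp (2 * n * (1 / ξ)) = 1 := by
      rw [← Real.exp_add, Real.exp_eq_one_iff]
      ring
    rw [inv_le_iff_one_le_mul₀ ht₀, ← h4]
    have h5 := Real.exp_pos (-2 * n / ξ)
    nlinarith
  have heval : ∀ x, (C t₀⁻¹ * (Chebyshev.T ℝ n).comp (C (1 + δE / Ec) - C (1 / Ec) * X)).eval x
      = t₀⁻¹ * (Chebyshev.T ℝ n).eval (1 + (δE - x) / Ec) := by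
    intro x
    rw [eval_mul, eval_C, eval_comp, eval_sub, eval_C, eval_mul, eval_C, eval_X]
    congr 2
    ring
  refine ⟨C t₀⁻¹ * (Chebyshev.T ℝ n).comp (C (1 + δE / Ec) - C (1 / Ec) * X), ?_, ?_, ?_, ?_⟩
  · refine (natDegree_C_mul_le _ _).trans (natDegree_comp_le.trans ?_)
    rw [Chebyshev.natDegree_T, Int.natAbs_natCast]
    refine (Nat.mul_le_mul_left n ?_).trans_eq (mul_one n)
    compute_degree
  · rw [heval, sub_zero]
    exact inv_mul_cancel₀ ht₀.ne'
  · intro x hx1 hx2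
    rw [heval, abs_mul, abs_of_pos (inv_pos.2 ht₀), ← mul_one (2 * _)]
    refine mul_le_mul hinv (Chebyshev.abs_eval_T_real_le_one n (abs_le.2 ⟨?_, ?_⟩))
      (abs_nonneg _) (by positivity)
    · have : -2 ≤ (δE - x) / Ec := by rw [le_div_iff₀ hEc]; linarith
      linarith
    · have : (δE - x) / Ec ≤ 0 := div_nonpos_of_nonpos_of_nonneg (by linarith) hEc.le
      linarith
  · intro x hx B hB
    have hneg : 1 + (δE - x) / Ec = -(1 + (x - δE - 2 * Ec) / Ec) := by
      field_simp
      ring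
    rw [heval, abs_mul, abs_of_pos (inv_pos.2 ht₀)]
    refine mul_le_mul hinv ?_ (abs_nonneg _) (by positivity)
    rw [hneg, Chebyshev.T_eval_neg, abs_mul]
    have h6 : |((Int.negOnePow n : ℤˣ) : ℝ)| = 1 := by
      rcases Int.units_eq_one_or (Int.negOnePow n) with h | h <;> simp [h]
    rw [h6, one_mul]
    exact abs_eval_T_one_add_le n (div_nonneg (by linarith) hEc.le) hB

end Chebyshev

/-! ### Functions of a self-adjoint operator -/

section Spectral

open NormedSpace

/-- Parseval's identity for an operator that is diagonal in the orthonormal basis `b`. -/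
theorem OrthonormalBasis.sq_norm_apply_eq_sum {ι E : Type*} [Fintype ι] [NormedAddCommGroup E]
    [InnerProductSpace ℂ E] (b : OrthonormalBasis ι ℂ E) (T : E →L[ℂ] E) {μ : ι → ℂ}
    (hT : ∀ i, T (b i) = μ i • b i) (ψ : E) :
    ‖T ψ‖ ^ 2 = ∑ i, ‖μ i‖ ^ 2 * ‖inner ℂ (b i) ψ‖ ^ 2 := by
  rw [← b.sum_sq_norm_inner_right (T ψ)]
  refine Finset.sum_congr rfl fun i _ => ?_
  rw [← mul_pow, ← norm_mul]
  congr 2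
  conv_lhs => rw [← b.sum_repr' ψ, map_sum, inner_sum]
  rw [Finset.sum_eq_single i]
  · rw [map_smul, hT, inner_smul_right, inner_smul_right, b.inner_eq_one]
    ring
  · intro j _ hj
    rw [map_smul, hT, inner_smul_right, inner_smul_right, b.inner_eq_zero hj.symm]
    ring
  · simp

theorem pow_apply_of_apply_eq_smul {E : Type*} [NormedAddCommGroup E] [NormedSpace ℂ E]
    {T : E →L[ℂ] E} {x : E} {μ : ℂ} (h : T x = μ • x) (m : ℕ) : (T ^ m) x = μ ^ m • x := by
  induction m with
  | zero => simp
  | succ m ih => rw [pow_succ', mul_apply_eq_comp, ih, map_smul, h, smul_smul, pow_succ]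

theorem exp_apply_of_apply_eq_smul {E : Type*} [NormedAddCommGroup E] [NormedSpace ℂ E]
    [CompleteSpace E] {T : E →L[ℂ] E} {x : E} {μ : ℂ} (h : T x = μ • x) :
    exp T x = Complex.exp μ • x := by
  have hpow := pow_apply_of_apply_eq_smul h
  refine (hasSum_exp_apply T x).unique ?_
  have h1 := (exp_series_hasSum_exp' (𝕂 := ℂ) μ).smul_const x
  rw [← Complex.exp_eq_exp_ℂ] at h1
  simpa only [hpow, smul_smul, smul_eq_mul] using h1

theorem aeval_apply_of_apply_eq_smul {E : Type*} [NormedAddCommGroup E] [NormedSpace ℂ E]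
    {T : E →L[ℂ] E} {x : E} {μ : ℂ} (h : T x = μ • x) (p : Polynomial ℂ) :
    Polynomial.aeval T p x = p.eval μ • x := by
  have hpow := pow_apply_of_apply_eq_smul h
  rw [Polynomial.aeval_eq_sum_range, Polynomial.eval_eq_sum_range, Finset.sum_smul]
  simp [hpow, smul_smul]

/-- A polynomial `p` with `p 0 = 1` acts on `ψ` almost as the projection onto the kernel of `H`,
if `p` is small on the nonzero eigenvalues up to a weight `c * exp (λ E)`, and the weight
`c * exp (λ H)` of `ψ` is under control. -/
theorem norm_aeval_apply_sub_le {E : Type*} [NormedAddCommGroup E] [InnerProductSpace ℂ E]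
    [FiniteDimensional ℂ E] {H : E →L[ℂ] E} (hH : IsSelfAdjoint H) {Ω : E} (hΩ : ‖Ω‖ = 1)
    (hHΩ : H Ω = 0) (huniq : ∀ ψ, H ψ = 0 → ∃ c : ℂ, ψ = c • Ω) (p : Polynomial ℝ)
    (hp0 : p.eval 0 = 1) {M G c l : ℝ} (hM : 0 ≤ M)
    (hp : ∀ μ : ℝ, Module.End.HasEigenvalue (H : E →ₗ[ℂ] E) (μ : ℂ) → μ ≠ 0 →
      |p.eval μ| ≤ M * max 1 (c * Real.exp (l * μ)))
    {ψ : E} (hψ : ‖ψ‖ ≤ G) (hexp : |c| * ‖exp ((l : ℂ) • H) ψ‖ ≤ G) :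
    ‖Polynomial.aeval H (p.map (algebraMap ℝ ℂ)) ψ - inner ℂ Ω ψ • Ω‖ ≤ 2 * M * G := by
  have := FiniteDimensional.complete ℂ E
  have hsym : (H : E →ₗ[ℂ] E).IsSymmetric := hH.isSymmetric
  set b := hsym.eigenvectorBasis rfl with hb
  set μ := hsym.eigenvalues rfl with hμ
  have hHb : ∀ i, H (b i) = (μ i : ℂ) • b i := hsym.apply_eigenvectorBasis rfl
  have hev : ∀ i, Module.End.HasEigenvalue (H : E →ₗ[ℂ] E) (μ i : ℂ) :=
    hsym.hasEigenvalue_eigenvalues rfl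
  set P := Polynomial.aeval H (p.map (algebraMap ℝ ℂ)) with hP
  have heval : ∀ x : ℝ, (p.map (algebraMap ℝ ℂ)).eval (x : ℂ) = (p.eval x : ℝ) := by
    intro x
    rw [Polynomial.eval_map]
    exact (Polynomial.hom_eval₂ p (RingHom.id ℝ) (algebraMap ℝ ℂ) x).symm
  have hPb : ∀ i, P (b i) = ((p.eval (μ i) : ℝ) : ℂ) • b i := fun i => by
    rw [hP, aeval_apply_of_apply_eq_smul (hHb i), heval]
  have hEb : ∀ i, exp ((l : ℂ) • H) (b i) = ((Real.exp (l * μ i) : ℝ) : ℂ) • b i := fun i => by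
    rw [exp_apply_of_apply_eq_smul (μ := ((l * μ i : ℝ) : ℂ)), Complex.ofReal_exp]
    rw [smul_apply, hHb, smul_smul, Complex.ofReal_mul]
  have hPΩ : P Ω = Ω := by
    have h0 : H Ω = ((0 : ℝ) : ℂ) • Ω := by simp [hHΩ]
    rw [hP, aeval_apply_of_apply_eq_smul h0, heval, hp0]
    simp
  -- The component of `ψ` orthogonal to `Ω` has no overlap with the kernel of `H`.
  set χ := ψ - inner ℂ Ω ψ • Ω with hχ
  have hPχ : P ψ - inner ℂ Ω ψ • Ω = P χ := by rw [hχ, map_sub, map_smul, hPΩ]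
  have hΩχ : inner ℂ Ω χ = 0 := by
    rw [hχ, inner_sub_right, inner_smul_right, inner_self_eq_norm_sq_to_K, hΩ]
    simp
  have hcoef : ∀ i, ‖((p.eval (μ i) : ℝ) : ℂ)‖ ^ 2 * ‖inner ℂ (b i) χ‖ ^ 2 ≤
      M ^ 2 * (‖inner ℂ (b i) ψ‖ ^ 2 +
        c ^ 2 * (‖((Real.exp (l * μ i) : ℝ) : ℂ)‖ ^ 2 * ‖inner ℂ (b i) ψ‖ ^ 2)) := by
    intro i
    by_cases hi : μ i = 0
    · obtain ⟨z, hz⟩ := huniq (b i) (by simp [hHb, hi])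
      rw [hz, inner_smul_left, hΩχ]
      simp only [mul_zero, norm_zero, ne_eq, OfNat.ofNat_ne_zero, not_false_eq_true, zero_pow]
      positivity
    · have hbΩ : inner ℂ (b i) Ω = 0 := by
        have h1 : inner ℂ (H (b i)) Ω = inner ℂ (b i) (H Ω) := hsym (b i) Ω
        rw [hHb, hHΩ, inner_smul_left, inner_zero_right, mul_eq_zero] at h1
        exact h1.resolve_left (by simpa using hi)
      have hbχ : inner ℂ (b i) χ = inner ℂ (b i) ψ := by
        rw [hχ, inner_sub_right, inner_smul_right, hbΩ, mul_zero, sub_zero]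
      rw [hbχ, Complex.norm_real, Real.norm_eq_abs, Complex.norm_real, Real.norm_eq_abs, Real.abs_exp]
      have h2 : |p.eval (μ i)| ^ 2 ≤ M ^ 2 * (1 + c ^ 2 * Real.exp (l * μ i) ^ 2) := by
        have h3 := pow_le_pow_left₀ (abs_nonneg _) (hp (μ i) (hev i) hi) 2
        refine h3.trans ?_
        rw [mul_pow]
        gcongr
        rcases max_choice 1 (c * Real.exp (l * μ i)) with h | h <;> rw [h]
        · have : 0 ≤ c ^ 2 * Real.exp (l * μ i) ^ 2 := by positivity
          linarith
        · rw [mul_pow]; linarith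
      calc _ ≤ M ^ 2 * (1 + c ^ 2 * Real.exp (l * μ i) ^ 2) * ‖inner ℂ (b i) ψ‖ ^ 2 := by gcongr
        _ = _ := by ring
  have hG : 0 ≤ G := (norm_nonneg ψ).trans hψ
  have hsq : ‖P χ‖ ^ 2 ≤ (2 * M * G) ^ 2 := by
    have h4 : (|c| * ‖exp ((l : ℂ) • H) ψ‖) ^ 2 ≤ G ^ 2 := by gcongr
    have h5 : ‖ψ‖ ^ 2 ≤ G ^ 2 := by gcongr
    rw [mul_pow, sq_abs] at h4
    calc ‖P χ‖ ^ 2 = _ := b.sq_norm_apply_eq_sum P hPb χ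
      _ ≤ _ := Finset.sum_le_sum fun i _ => hcoef i
      _ = M ^ 2 * (‖ψ‖ ^ 2 + c ^ 2 * ‖exp ((l : ℂ) • H) ψ‖ ^ 2) := by
        rw [← Finset.mul_sum, Finset.sum_add_distrib, ← Finset.mul_sum,
          b.sum_sq_norm_inner_right, ← b.sq_norm_apply_eq_sum _ hEb]
      _ ≤ M ^ 2 * (G ^ 2 + G ^ 2) := by gcongr
      _ ≤ (2 * M * G) ^ 2 := by nlinarith [sq_nonneg (M * G)]
  rw [hPχ]
  exact le_of_sq_le_sq hsq (by positivity)

end Spectral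

/-! ### Energy distribution after a local perturbation -/

section LocalHamiltonian

open NormedSpace

variable {Λ : Type*} [Fintype Λ] [DecidableEq Λ] {d k : ℕ} {g : ℝ}

theorem LocalHamiltonian.isSelfAdjoint_op (H : LocalHamiltonian Λ d k g) : IsSelfAdjoint H.op :=
  isSelfAdjoint_sum (R := SpinOp Λ d) Finset.univ fun X _ => H.selfAdjoint X

/-- The terms of `H` that do not act on `L`. -/
noncomputable def LocalHamiltonian.awayFrom (H : LocalHamiltonian Λ d k g) (L : Finset Λ) :
    LocalHamiltonian Λ d k g where
  term X := if Disjoint X L then H.term X else 0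
  supported X := by
    split_ifs
    · exact H.supported X
    · exact SupportedOn.zero X
  selfAdjoint X := by
    split_ifs
    · exact H.selfAdjoint X
    · exact IsSelfAdjoint.zero (SpinOp Λ d)
  term_eq_zero X hX := by rw [H.term_eq_zero X hX, ite_self]
  sum_norm_le i := by
    refine (Finset.sum_le_sum fun X _ => ?_).trans (H.sum_norm_le i)
    split_ifs
    · exact le_rfl
    · simp

theorem LocalHamiltonian.op_sub_op_awayFrom (H : LocalHamiltonian Λ d k g) (L : Finset Λ) :
    H.op - (H.awayFrom L).op = ∑ X : Finset Λ with ¬ Disjoint X L, H.term X := by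
  rw [LocalHamiltonian.op, LocalHamiltonian.op, ← Finset.sum_sub_distrib, Finset.sum_filter]
  refine Finset.sum_congr rfl fun X _ => ?_
  by_cases h : Disjoint X L <;> simp [awayFrom, h]

theorem LocalHamiltonian.commute_op_awayFrom (H : LocalHamiltonian Λ d k g) {L : Finset Λ}
    {Γ : SpinOp Λ d} (hΓ : SupportedOn L Γ) : Commute (H.awayFrom L).op Γ := by
  refine Commute.sum_left _ _ _ fun X _ => ?_
  by_cases h : Disjoint X L
  · simpa [awayFrom, h, Commute, SemiconjBy] using (H.supported X).mul_comm_of_disjoint h hΓ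
  · simp [awayFrom, h]

/-- The terms acting on `L` have total norm at most `g |L|`. -/
theorem LocalHamiltonian.sum_norm_term_le (H : LocalHamiltonian Λ d k g) (L : Finset Λ) :
    ∑ X : Finset Λ with ¬ Disjoint X L, ‖H.term X‖ ≤ g * L.card := by
  calc ∑ X : Finset Λ with ¬ Disjoint X L, ‖H.term X‖
      ≤ ∑ i ∈ L, ∑ X : Finset Λ with i ∈ X, ‖H.term X‖ := by
        simp only [Finset.sum_filter]
        rw [Finset.sum_comm]
        refine Finset.sum_le_sum fun X _ => ?_
        have hnn : ∀ i ∈ L, 0 ≤ if i ∈ X then ‖H.term X‖ else 0 := fun i _ => by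
          split_ifs <;> simp
        split_ifs with h
        · exact Finset.sum_nonneg hnn
        · obtain ⟨i, hiX, hiL⟩ := Finset.not_disjoint_iff.1 h
          exact (by simp [hiX] : ‖H.term X‖ ≤ if i ∈ X then ‖H.term X‖ else 0).trans
            (Finset.single_le_sum hnn hiL)
    _ ≤ ∑ i ∈ L, g := Finset.sum_le_sum fun i _ => H.sum_norm_le i
    _ = g * L.card := by rw [Finset.sum_const, nsmul_eq_mul, mul_comm]

theorem LocalHamiltonian.lie_op_eq (H : LocalHamiltonian Λ d k g) {Y : Finset Λ} {A : SpinOp Λ d}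
    (hA : SupportedOn Y A) :
    ⁅H.op, A⁆ = ∑ X : Finset Λ with ¬ Disjoint X Y, ⁅H.term X, A⁆ := by
  rw [LocalHamiltonian.op, Ring.lie_def, Finset.sum_mul, Finset.mul_sum, ← Finset.sum_sub_distrib,
    Finset.sum_filter]
  refine Finset.sum_congr rfl fun X _ => ?_
  by_cases h : Disjoint X Y
  · rw [if_neg (not_not.2 h), (H.supported X).mul_comm_of_disjoint h hA, sub_self]
  · rw [if_pos h, Ring.lie_def]

/-- Iterated commutators of a local Hamiltonian with an operator on at most `r * k` spins: each
commutator enlarges the support by at most `k` spins. -/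
theorem LocalHamiltonian.norm_iterate_lie_le (H : LocalHamiltonian Λ d k g) (hg : 0 ≤ g) (m : ℕ) :
    ∀ (r : ℕ) (Y : Finset Λ) (A : SpinOp Λ d), Y.card ≤ r * k → SupportedOn Y A →
      ‖(fun C : SpinOp Λ d => ⁅H.op, C⁆)^[m] A‖
        ≤ ‖A‖ * (2 * g * k) ^ m * (r.ascFactorial m : ℕ) := by
  induction m with
  | zero => intro r Y A _ _; simp
  | succ m ih =>
    intro r Y A hY hA
    rw [Function.iterate_succ_apply, H.lie_op_eq hA, iterate_lie_sum]
    set D : ℝ := (2 * g * k) ^ m * ((r + 1).ascFactorial m : ℕ) with hD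
    have hD0 : 0 ≤ D := by positivity
    have hterm : ∀ X : Finset Λ, ‖(fun C : SpinOp Λ d => ⁅H.op, C⁆)^[m] ⁅H.term X, A⁆‖
        ≤ ‖H.term X‖ * (2 * ‖A‖ * D) := by
      intro X
      by_cases hX : X.card ≤ k
      · have hsupp : SupportedOn (X ∪ Y) ⁅H.term X, A⁆ := by
          rw [Ring.lie_def]
          exact ((H.supported X).mul hA).sub (Finset.union_comm X Y ▸ hA.mul (H.supported X))
        have hcard : (X ∪ Y).card ≤ (r + 1) * k := by
          have := Finset.card_union_le X Y
          rw [Nat.succ_mul]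
          omega
        have hnorm : ‖⁅H.term X, A⁆‖ ≤ 2 * ‖H.term X‖ * ‖A‖ := by
          rw [Ring.lie_def]
          refine (norm_sub_le _ _).trans ?_
          have h1 := norm_mul_le (H.term X) A
          have h2 := norm_mul_le A (H.term X)
          linarith
        refine (ih (r + 1) _ _ hcard hsupp).trans ?_
        rw [mul_assoc, ← hD]
        calc _ ≤ 2 * ‖H.term X‖ * ‖A‖ * D := by gcongr
          _ = _ := by ring
      · rw [H.term_eq_zero X (not_le.1 hX), Ring.lie_def, zero_mul, mul_zero, sub_zero, iterate_lie_zero]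
        simp
    calc _ ≤ ∑ X : Finset Λ with ¬ Disjoint X Y, ‖H.term X‖ * (2 * ‖A‖ * D) :=
          norm_sum_le_of_le _ fun X _ => hterm X
      _ ≤ (g * (r * k : ℕ)) * (2 * ‖A‖ * D) := by
          rw [← Finset.sum_mul]
          gcongr
          refine (H.sum_norm_term_le Y).trans ?_
          gcongr
      _ = _ := by
          have hasc : r * (r + 1).ascFactorial m = r.ascFactorial (m + 1) := by
            rw [Nat.ascFactorial_succ]; exact Nat.succ_ascFactorial r m
          rw [hD, ← hasc]
          push_cast
          ring

/-- The energy change caused by the terms acting on `L`, in imaginary time `t`: up to second order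
in `t` it is at most the total norm of these terms. The terms evolve under any `k`-local
Hamiltonian `K` with the same constants. -/
theorem LocalHamiltonian.abs_re_inner_exp_conj_le (H K : LocalHamiltonian Λ d k g) (hg : 0 ≤ g)
    (L : Finset Λ) {t : ℝ} (ht : (2 * g * k * t) ^ 2 ≤ 1 / 2) (x : SpinSpace Λ d) :
    |(inner ℂ x ((exp ((t : ℂ) • K.op) * (H.op - (H.awayFrom L).op) *
      exp (-((t : ℂ) • K.op))) x)).re|
      ≤ g * L.card * (1 + 2 * (2 * g * k) ^ 2 * t ^ 2) * ‖x‖ ^ 2 := by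
  set v := 2 * g * k * t with hv
  have hv1 : |v| < 1 := by rw [← sq_lt_one_iff_abs_lt_one]; linarith
  have hgeo : 1 / (1 - v ^ 2) ≤ 1 + 2 * (2 * g * k) ^ 2 * t ^ 2 := by
    rw [div_le_iff₀ (by linarith)]
    have : (2 * g * k) ^ 2 * t ^ 2 = v ^ 2 := by rw [hv]; ring
    rw [mul_assoc, this]
    nlinarith [sq_nonneg v]
  rw [H.op_sub_op_awayFrom, Finset.mul_sum, Finset.sum_mul, sum_apply,
    inner_sum, Complex.re_sum]
  have hterm : ∀ X : Finset Λ, |(inner ℂ x ((exp ((t : ℂ) • K.op) * H.term X *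
      exp (-((t : ℂ) • K.op))) x)).re| ≤ ‖H.term X‖ * (‖x‖ ^ 2 / (1 - v ^ 2)) := by
    intro X
    have hb : ∀ m : ℕ, ‖(fun C : SpinOp Λ d => ⁅K.op, C⁆)^[m] (H.term X)‖
        ≤ ‖H.term X‖ * (2 * g * k) ^ m * m.factorial := by
      intro m
      by_cases hX : X.card ≤ k
      · have := K.norm_iterate_lie_le hg m 1 X (H.term X) (by simpa using hX) (H.supported X)
        rwa [Nat.one_ascFactorial] at this
      · rw [H.term_eq_zero X (not_le.1 hX), iterate_lie_zero]
        simp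
    rw [← mul_div_assoc]
    exact re_inner_exp_conj_le K.isSelfAdjoint_op (H.selfAdjoint X) hb hv1 x
  refine (Finset.abs_sum_le_sum_abs _ _).trans ((Finset.sum_le_sum fun X _ => hterm X).trans ?_)
  rw [← Finset.sum_mul]
  have h1 : 0 < 1 - v ^ 2 := by linarith
  calc _ ≤ g * L.card * (‖x‖ ^ 2 / (1 - v ^ 2)) := by
        gcongr
        exact H.sum_norm_term_le L
    _ = g * L.card * (1 / (1 - v ^ 2)) * ‖x‖ ^ 2 := by ring
    _ ≤ _ := by gcongr

/-- High energies are exponentially suppressed in `Γ Ω`. With `K` the Hamiltonian away from `L`,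
`exp (lH) Γ Ω` is `(exp (lH) exp (-lK)) Γ (exp (lK) exp (-lH)) Ω`, and each of the two
parenthesized factors costs the energy `g |L|` of the terms acting on `L`. The correction is of
third order in `l`. -/
theorem LocalHamiltonian.norm_exp_apply_le (H : LocalHamiltonian Λ d k g) (hg : 0 ≤ g)
    {L : Finset Λ} {Γ : SpinOp Λ d} (hΓ : SupportedOn L Γ) {Ω : SpinSpace Λ d} (hΩ : ‖Ω‖ = 1)
    (hHΩ : H.op Ω = 0) {l : ℝ} (hl : 0 ≤ l) (hl' : (2 * g * k * l) ^ 2 ≤ 1 / 2) :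
    ‖exp ((l : ℂ) • H.op) (Γ Ω)‖
      ≤ ‖Γ‖ * Real.exp (2 * (g * L.card) * (l + 2 / 3 * (2 * g * k) ^ 2 * l ^ 3)) := by
  set K := H.awayFrom L with hK
  set α : ℝ → ℝ := fun t => g * L.card * (t + 2 / 3 * (2 * g * k) ^ 2 * t ^ 3) with hα
  have hαder : ∀ t, HasDerivAt α (g * L.card * (1 + 2 * (2 * g * k) ^ 2 * t ^ 2)) t := by
    intro t
    have h := ((hasDerivAt_id t).add
      ((hasDerivAt_pow 3 t).const_mul (2 / 3 * (2 * g * k) ^ 2))).const_mul (g * L.card)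
    refine h.congr_deriv ?_
    push_cast
    ring
  have hα0 : α 0 = 0 := by simp [hα]
  have hsmall : ∀ t ∈ Set.Icc 0 l, (2 * g * k * t) ^ 2 ≤ 1 / 2 := by
    intro t ht
    refine le_trans ?_ hl'
    have := ht.1
    have := ht.2
    gcongr
  -- The evolution generated by `H` is compared with the one generated by `K`, in both orders.
  have h1 : ∀ x, ‖exp ((l : ℂ) • H.op) (exp (-((l : ℂ) • K.op)) x)‖
      ≤ Real.exp (α l) * ‖x‖ :=
    norm_exp_mul_exp_neg_apply_le hl hαder hα0 fun t ht x =>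
      (le_abs_self _).trans (H.abs_re_inner_exp_conj_le H hg L (hsmall t ht) x)
  have h2 : ∀ x, ‖exp ((l : ℂ) • K.op) (exp (-((l : ℂ) • H.op)) x)‖
      ≤ Real.exp (α l) * ‖x‖ := by
    refine norm_exp_mul_exp_neg_apply_le hl hαder hα0 fun t ht x => ?_
    have h := H.abs_re_inner_exp_conj_le K hg L (hsmall t ht) x
    rw [← neg_sub H.op, mul_neg, neg_mul, neg_apply, inner_neg_right, Complex.neg_re]
    exact (neg_le_abs _).trans h
  have hΩ2 : exp (-((l : ℂ) • H.op)) Ω = Ω := by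
    rw [exp_apply_of_apply_eq_smul (μ := 0) (by simp [hHΩ]), Complex.exp_zero, one_smul]
  -- `Γ` commutes with the evolution generated by the terms away from `L`.
  have hcomm : Γ Ω = exp (-((l : ℂ) • K.op)) (Γ (exp ((l : ℂ) • K.op) Ω)) := by
    have hc : Commute (exp ((l : ℂ) • K.op)) Γ :=
      ((H.commute_op_awayFrom hΓ).smul_left (l : ℂ)).exp_left
    rw [← mul_apply_eq_comp Γ, ← hc.eq, mul_apply_eq_comp, ← mul_apply_eq_comp (exp _),
      exp_neg_mul_exp, one_apply_eq_self]
  rw [hcomm]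
  calc _ ≤ Real.exp (α l) * ‖Γ (exp ((l : ℂ) • K.op) Ω)‖ := h1 _
    _ ≤ Real.exp (α l) * (‖Γ‖ * ‖exp ((l : ℂ) • K.op) Ω‖) := by gcongr; exact Γ.le_opNorm _
    _ ≤ Real.exp (α l) * (‖Γ‖ * (Real.exp (α l) * 1)) := by
        gcongr
        have := h2 Ω
        rwa [hΩ2, hΩ] at this
    _ = ‖Γ‖ * (Real.exp (α l) * Real.exp (α l)) := by ring
    _ = _ := by rw [← Real.exp_add]; congr 2; rw [hα]; ring

end LocalHamiltonian

/-! ### Reversal of local perturbations -/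

section Reversal

variable {Λ : Type*} [Fintype Λ] [DecidableEq Λ] {d k : ℕ} {g : ℝ}

/-- A Hamiltonian with two different energies has a nontrivial interaction. -/
theorem IsUniqueGroundState.coupling_pos {H : LocalHamiltonian Λ d k g} {Ω : SpinSpace Λ d}
    {δE : ℝ} (hΩ : IsUniqueGroundState H.op Ω δE) : 0 < g := by
  by_contra! hg
  have hterm : ∀ X : Finset Λ, X ≠ ∅ → H.term X = 0 := by
    intro X hX
    obtain ⟨i, hi⟩ := Finset.nonempty_iff_ne_empty.2 hX
    have h1 : ‖H.term X‖ ≤ ∑ Y : Finset Λ with i ∈ Y, ‖H.term Y‖ :=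
      Finset.single_le_sum (f := fun Y => ‖H.term Y‖) (fun _ _ => norm_nonneg _) (by simp [hi])
    exact norm_le_zero_iff.1 ((h1.trans (H.sum_norm_le i)).trans hg)
  have hop : H.op = H.term ∅ :=
    Finset.sum_eq_single ∅ (fun X _ hX => hterm X hX) (by simp)
  obtain ⟨c, hc⟩ := (H.supported ∅).exists_eq_smul_one
  have hΩ0 : Ω ≠ 0 := norm_ne_zero_iff.1 (by rw [hΩ.norm_eq_one]; exact one_ne_zero)
  have hc0 : c = 0 := by
    have h2 := hΩ.apply_eq_zero
    rw [hop, hc, smul_apply, one_apply_eq_self] at h2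
    exact (smul_eq_zero.1 h2).resolve_right hΩ0
  obtain ⟨⟨hev, hpos⟩, -⟩ := hΩ.gap
  obtain ⟨v, hv⟩ := Module.End.HasEigenvalue.exists_hasEigenvector hev
  have h3 := hv.apply_eq_smul
  rw [hop, hc, hc0] at h3
  have h4 : (δE : ℂ) • v = 0 := by rw [← h3]; simp
  exact hpos.ne' (by exact_mod_cast (smul_eq_zero.1 h4).resolve_right hv.2)

/-- The imaginary time at which the suppression of high energies in `Γ Ω` outweighs the growth
of the filter polynomial above the cutoff. -/
theorem exists_imaginary_time {g : ℝ} (hg : 0 < g) {k : ℕ} (hk : 0 < k) (l : ℕ) {n : ℕ}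
    (hn : 0 < n) :
    ∃ t : ℝ, 0 < t ∧ (2 * g * k * t) ^ 2 ≤ 1 / 2 ∧
      2 * (g * l) * (t + 2 / 3 * (2 * g * k) ^ 2 * t ^ 3)
        + n ^ 2 / (2 * (t * energyCutoff g k l n)) ≤ 2 * (t * energyCutoff g k l n) := by
  set Ec := energyCutoff g k l n with hEc
  have hk' : (0 : ℝ) < k := by exact_mod_cast hk
  have hn' : (0 : ℝ) < n := by exact_mod_cast hn
  have hEc1 : Ec = g * l + 8 * g * k * n := rfl
  have hgl : 0 ≤ g * l := by positivity
  have hgkn : 0 < g * k * n := by positivity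
  have hEc0 : 0 < Ec := by rw [hEc1]; linarith
  -- The choice balances `n² / (t Ec)` against `g k n t`; both are then of the order
  -- `(g k)² t³ Ec`, like the third-order correction.
  set t := √(n / (4 * g * k * Ec)) with ht
  have ht0 : 0 < t := Real.sqrt_pos.2 (by positivity)
  have ht2 : t ^ 2 = n / (4 * g * k * Ec) := Real.sq_sqrt (by positivity)
  have hnt : (n : ℝ) = 4 * g * k * Ec * t ^ 2 := by
    rw [ht2]
    field_simp
  refine ⟨t, ht0, ?_, ?_⟩
  · have h1 : (2 * g * k * t) ^ 2 = g * k * n / Ec := by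
      rw [mul_pow, ht2]
      field_simp
      ring
    rw [h1, div_le_iff₀ hEc0]
    linarith
  · have h2 : (n : ℝ) ^ 2 / (2 * (t * Ec)) = 8 * (g * k) ^ 2 * t ^ 3 * Ec := by
      rw [hnt]
      field_simp
      ring
    have h3 : 2 * (t * Ec) = 2 * (g * l) * t + 64 * (g * k) ^ 2 * t ^ 3 * Ec := by
      have : 16 * (g * k) * t * n = 64 * (g * k) ^ 2 * t ^ 3 * Ec := by
        conv_lhs => rw [hnt]
        ring
      rw [← this, hEc1]
      ring
    have h4 : g * l ≤ Ec := by rw [hEc1]; linarith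
    have h5 : (g * k) ^ 2 * t ^ 3 * (g * l) ≤ (g * k) ^ 2 * t ^ 3 * Ec := by gcongr
    have h6 : 0 ≤ (g * k) ^ 2 * t ^ 3 * Ec := by positivity
    rw [h2, h3]
    linarith

/-- The reversing operator is a polynomial filter of the Hamiltonian, of degree `q / k`, divided
by `⟨Ω|Γ|Ω⟩`. -/
theorem IsUniqueGroundState.exists_isQLocal_reversal (hk : 0 < k) {H : LocalHamiltonian Λ d k g}
    {Ω : SpinSpace Λ d} {δE : ℝ} (hΩ : IsUniqueGroundState H.op Ω δE) {L : Finset Λ}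
    {Γ : SpinOp Λ d} (hΓ : SupportedOn L Γ) (hne : inner ℂ Ω (Γ Ω) ≠ 0) (q : ℕ) :
    ∃ R : SpinOp Λ d, IsQLocal q R ∧
      ‖R (Γ Ω) - Ω‖ ≤ 6 * ‖Γ‖ / ‖inner ℂ Ω (Γ Ω)‖ *
        Real.exp (-2 * ((q / k : ℕ) : ℝ) /
          reversalLength (energyCutoff g k L.card (q / k)) δE) := by
  have hg := hΩ.coupling_pos
  have hδ : 0 < δE := hΩ.gap.1.2
  have hin : 0 < ‖inner ℂ Ω (Γ Ω)‖ := norm_pos_iff.2 hne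
  have hΓΩ : ‖Γ Ω‖ ≤ ‖Γ‖ := by simpa [hΩ.norm_eq_one] using Γ.le_opNorm Ω
  -- For `q < k` the bound is at least `6`, and `R = 0` is good enough.
  rcases Nat.eq_zero_or_pos (q / k) with hn | hn
  · refine ⟨0, IsQLocal.zero q, ?_⟩
    have h1 : ‖inner ℂ Ω (Γ Ω)‖ ≤ ‖Γ‖ := by
      refine (norm_inner_le_norm _ _).trans ?_
      rwa [hΩ.norm_eq_one, one_mul]
    rw [zero_apply, zero_sub, norm_neg, hΩ.norm_eq_one, hn]
    simp only [CharP.cast_eq_zero, mul_zero, zero_div, Real.exp_zero, mul_one]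
    rw [le_div_iff₀ hin]
    linarith
  set n := q / k with hn_def
  set Ec := energyCutoff g k L.card n with hEc
  have hk' : (0 : ℝ) < k := by exact_mod_cast hk
  have hEc0 : 0 < Ec := by
    have hn' : (0 : ℝ) < n := by exact_mod_cast hn
    rw [hEc, energyCutoff]
    positivity
  obtain ⟨p, hpdeg, hp0, hplow, hphigh⟩ := exists_filter_polynomial n hEc0 hδ
  obtain ⟨t, ht0, htsmall, ht⟩ := exists_imaginary_time hg hk L.card hn
  set e := Real.exp (-2 * n / reversalLength Ec δE) with he
  set α := 2 * (g * L.card) * (t + 2 / 3 * (2 * g * k) ^ 2 * t ^ 3) with hα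
  have hexp := H.norm_exp_apply_le hg.le hΓ hΩ.norm_eq_one hΩ.apply_eq_zero ht0.le htsmall
  have hbound := norm_aeval_apply_sub_le H.isSelfAdjoint_op hΩ.norm_eq_one hΩ.apply_eq_zero
    hΩ.unique p hp0 (M := 2 * e) (G := ‖Γ‖) (c := Real.exp (-α)) (l := t) (by positivity)
    -- Above the window, the growth of `p` is absorbed by the weight `exp (t μ - α)`.
    (fun μ hμ hμ0 => by
      have hμpos : 0 < μ := lt_of_le_of_ne (hΩ.ground_energy.2 hμ) hμ0.symm
      have hμδ : δE ≤ μ := hΩ.gap.2 ⟨hμ, hμpos⟩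
      rcases le_total μ (δE + 2 * Ec) with h | h
      · refine (hplow μ hμδ h).trans ?_
        exact le_mul_of_one_le_right (by positivity) (le_max_left _ _)
      · refine (hphigh μ h (t * Ec) (by positivity)).trans ?_
        gcongr
        refine le_trans ?_ (le_max_right _ _)
        rw [← Real.exp_add, Real.exp_le_exp]
        have h1 : t * Ec * ((μ - δE - 2 * Ec) / Ec) = t * μ - t * δE - 2 * (t * Ec) := by
          field_simp
        have h2 : 0 < t * δE := by positivity
        rw [h1]
        linarith)
    hΓΩ (by
      rw [Real.abs_exp]
      calc _ ≤ Real.exp (-α) * (‖Γ‖ * Real.exp α) := by gcongr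
        _ = ‖Γ‖ * (Real.exp (-α) * Real.exp α) := by ring
        _ = ‖Γ‖ := by rw [← Real.exp_add, neg_add_cancel, Real.exp_zero, mul_one]
        _ ≤ ‖Γ‖ := le_rfl)
  refine ⟨(inner ℂ Ω (Γ Ω))⁻¹ • Polynomial.aeval H.op (p.map (algebraMap ℝ ℂ)),
    ((H.isQLocal_op.aeval _ (Polynomial.natDegree_map_le.trans hpdeg)).smul _).mono
      (Nat.div_mul_le_self q k), ?_⟩
  set P := Polynomial.aeval H.op (p.map (algebraMap ℝ ℂ))
  have hR : ((inner ℂ Ω (Γ Ω))⁻¹ • P) (Γ Ω) - Ω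
      = (inner ℂ Ω (Γ Ω))⁻¹ • (P (Γ Ω) - inner ℂ Ω (Γ Ω) • Ω) := by
    rw [smul_apply, smul_sub, smul_smul, inv_mul_cancel₀ hne, one_smul]
  rw [hR, norm_smul, norm_inv, div_mul_eq_mul_div, ← div_eq_inv_mul]
  refine div_le_div_of_nonneg_right (hbound.trans ?_) hin.le
  have : 0 ≤ e * ‖Γ‖ := by positivity
  linarith

end Reversal

/-! ### Superpolynomial decay of the error -/

section Decay

theorem decaysSuperpolynomially_exp_neg_sqrt {c : ℝ} (hc : 0 < c) (a b : ℝ) :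
    DecaysSuperpolynomially fun x => a * Real.exp (b - c * √x) := by
  have h : DecaysSuperpolynomially fun x => Real.exp (-(c * √x)) := by
    intro n
    have h1 : Filter.Tendsto (fun x => c * √x) Filter.atTop Filter.atTop :=
      Real.tendsto_sqrt_atTop.const_mul_atTop hc
    have h2 := ((Real.tendsto_pow_mul_exp_neg_atTop_nhds_zero (2 * n)).comp h1).const_mul
      ((c ^ (2 * n))⁻¹)
    rw [mul_zero] at h2
    refine h2.congr' ?_
    filter_upwards [Filter.eventually_ge_atTop 0] with x hx
    have h3 : √x ^ (2 * n) = x ^ n := by rw [pow_mul, Real.sq_sqrt hx]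
    rw [Function.comp_apply, mul_pow, h3]
    field_simp
  refine (h.const_mul (a * Real.exp b)).congr fun x => ?_
  rw [sub_eq_add_neg, Real.exp_add]
  ring

/-- The exponent of the reversal error in terms of the ratio `x = q / √l`. -/
theorem sqrt_div_le_div_reversalLength {k l q : ℕ} (hk : 0 < k) (hl : 0 < l) {g δ δE x : ℝ}
    (hg : 0 < g) (hδ : 0 < δ) (hδE : δ ≤ δE) (hx : x = q / √(l : ℝ)) (hkx : k < x) :
    √x / (2 * k * √(1 + 10 * g / δ))
      ≤ (q / k : ℕ) / reversalLength (energyCutoff g k l (q / k)) δE := by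
  set n := q / k with hn
  have hk1 : (1 : ℝ) ≤ k := by exact_mod_cast hk
  have hl1 : (1 : ℝ) ≤ l := by exact_mod_cast hl
  have hx1 : 1 ≤ x := hk1.trans hkx.le
  have hsl : 1 ≤ √(l : ℝ) := Real.one_le_sqrt.2 hl1
  have hxq : x * √(l : ℝ) = q := by rw [hx]; field_simp
  have hxleq : x ≤ q := by nlinarith
  have hkq : k ≤ q := by exact_mod_cast (hkx.le.trans hxleq)
  have hn1 : 1 ≤ n := (Nat.one_le_div_iff hk).2 hkq
  have hqn : (q : ℝ) ≤ 2 * k * n := by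
    have h1 : q < k * (n + 1) := Nat.lt_mul_div_succ q hk
    have h2 : q ≤ 2 * k * n := by nlinarith
    exact_mod_cast h2
  have hn1' : (1 : ℝ) ≤ n := by exact_mod_cast hn1
  have hEc : energyCutoff g k l n = g * l + 8 * g * k * n := rfl
  have hEc0 : 0 < energyCutoff g k l n := by rw [hEc]; positivity
  have hδE0 : 0 < δE := hδ.trans_le hδE
  set ξ := reversalLength (energyCutoff g k l n) δE with hξ
  have hξ2 : ξ ^ 2 = 1 + 2 * energyCutoff g k l n / δE := Real.sq_sqrt (by positivity)
  have hξ0 : 0 < ξ := Real.sqrt_pos.2 (by positivity)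
  have hxl : x * l ≤ 4 * k ^ 2 * n ^ 2 := by
    have h3 : x ^ 2 * l = q ^ 2 := by
      rw [← hxq, mul_pow, Real.sq_sqrt (by positivity)]
    have h4 : x * l ≤ x ^ 2 * l := by
      rw [sq]; gcongr; exact le_mul_of_one_le_left (by linarith) hx1
    have h5 : (q : ℝ) ^ 2 ≤ (2 * k * n) ^ 2 := by gcongr
    linarith
  have hxx : x ≤ 4 * k ^ 2 * n ^ 2 :=
    (le_mul_of_one_le_right (by linarith) hl1).trans hxl
  have hxn : x * n ≤ 2 * k * n ^ 2 := by
    rw [sq, ← mul_assoc]; gcongr; linarith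
  have hmain : x * ξ ^ 2 ≤ (2 * k * n) ^ 2 * (1 + 10 * g / δ) := by
    have h6 : 2 * energyCutoff g k l n / δE ≤ 2 * energyCutoff g k l n / δ := by gcongr
    have h7 : x * energyCutoff g k l n ≤ 20 * g * k ^ 2 * n ^ 2 := by
      have h8 : x * energyCutoff g k l n = g * (x * l) + 8 * g * k * (x * n) := by
        rw [hEc]; ring
      have h9 : 8 * g * k * (x * n) ≤ 8 * g * k * (2 * k * n ^ 2) := by gcongr
      have h10 : g * (x * l) ≤ g * (4 * k ^ 2 * n ^ 2) := by gcongr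
      rw [h8]
      linarith
    calc x * ξ ^ 2 ≤ x * (1 + 2 * energyCutoff g k l n / δ) := by rw [hξ2]; gcongr
      _ = x + 2 * (x * energyCutoff g k l n) / δ := by ring
      _ ≤ 4 * k ^ 2 * n ^ 2 + 2 * (20 * g * k ^ 2 * n ^ 2) / δ := by gcongr
      _ = _ := by ring
  have hsqrt : √x * ξ ≤ 2 * k * n * √(1 + 10 * g / δ) := by
    have h11 := Real.sqrt_le_sqrt hmain
    rwa [Real.sqrt_mul (by linarith), Real.sqrt_sq hξ0.le, Real.sqrt_mul (by positivity),
      Real.sqrt_sq (by positivity)] at h11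
  have hD : 0 < √(1 + 10 * g / δ) := Real.sqrt_pos.2 (by positivity)
  rw [div_le_div_iff₀ (by positivity) hξ0]
  linarith

end Decay

theorem theorem1 :
    -- the quantitative bound
    (∀ (Λ : Type*) [Fintype Λ] [DecidableEq Λ] (d k : ℕ) (g : ℝ), 0 < k →
      ∀ (H : LocalHamiltonian Λ d k g) (Ω : SpinSpace Λ d) (δE : ℝ),
        IsUniqueGroundState H.op Ω δE →
      ∀ (L : Finset Λ) (Γ : SpinOp Λ d), SupportedOn L Γ → inner ℂ Ω (Γ Ω) ≠ 0 →
      ∀ q : ℕ, 0 < q → ∃ R : SpinOp Λ d, IsQLocal q R ∧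
        ‖R (Γ Ω) - Ω‖ ≤ 6 * ‖Γ‖ / ‖inner ℂ Ω (Γ Ω)‖ *
          Real.exp (-2 * ((q / k : ℕ) : ℝ) /
            reversalLength (energyCutoff g k L.card (q / k)) δE)) ∧
    -- local reversibility, with a function that depends only on `k`, `g` and a bound on the gap
    (∀ (k : ℕ) (g δ : ℝ), 0 < k → 0 < δ →
      ∃ f : ℝ → ℝ, DecaysSuperpolynomially f ∧
        ∀ (Λ : Type*) [Fintype Λ] [DecidableEq Λ] (d : ℕ)
          (H : LocalHamiltonian Λ d k g) (Ω : SpinSpace Λ d) (δE : ℝ),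
          IsUniqueGroundState H.op Ω δE → δ ≤ δE → LocallyReversibleWith f Ω) := by
  refine ⟨fun Λ _ _ d k g hk H Ω δE hΩ L Γ hΓ hne q _ =>
    hΩ.exists_isQLocal_reversal hk hΓ hne q, fun k g δ hk hδ => ?_⟩
  -- A unique gapped ground state exists only for positive `g`.
  rcases le_or_gt g 0 with hg | hg
  · refine ⟨0, Asymptotics.superpolynomialDecay_zero _ _, fun Λ _ _ d H Ω δE hΩ _ => ?_⟩
    exact absurd hΩ.coupling_pos (not_lt.2 hg)
  have hk' : (0 : ℝ) < k := by exact_mod_cast hk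
  set D := k * √(1 + 10 * g / δ) with hD
  have hD0 : 0 < D := mul_pos hk' (Real.sqrt_pos.2 (by positivity))
  -- The shift of the exponent makes the bound trivial for `x ≤ k`.
  refine ⟨fun x => 6 * Real.exp (D⁻¹ * √k - D⁻¹ * √x),
    decaysSuperpolynomially_exp_neg_sqrt (inv_pos.2 hD0) _ _,
    fun Λ _ _ d H Ω δE hΩ hδE L hL Γ hΓ hne q _ => ?_⟩
  obtain ⟨R, hR, hbound⟩ := hΩ.exists_isQLocal_reversal hk hΓ hne q
  refine ⟨R, hR, hbound.trans ?_⟩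
  set x := q / √(L.card : ℝ) with hx
  rw [mul_div_assoc, mul_comm (6 : ℝ), mul_assoc]
  refine mul_le_mul_of_nonneg_left ?_ (div_nonneg (norm_nonneg _) (norm_nonneg _))
  refine mul_le_mul_of_nonneg_left (Real.exp_le_exp.2 ?_) (by norm_num)
  rcases le_or_gt x k with hxk | hxk
  · have h1 : D⁻¹ * √x ≤ D⁻¹ * √k := by gcongr
    have h2 : -2 * ((q / k : ℕ) : ℝ) / reversalLength (energyCutoff g k L.card (q / k)) δE ≤ 0 :=
      div_nonpos_of_nonpos_of_nonneg
        (mul_nonpos_of_nonpos_of_nonneg (by norm_num) (Nat.cast_nonneg _)) (Real.sqrt_nonneg _)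
    linarith
  · have h1 := sqrt_div_le_div_reversalLength hk hL.card_pos hg hδ hδE hx hxk
    have h2 : √x / (2 * k * √(1 + 10 * g / δ)) = D⁻¹ * √x / 2 := by
      rw [hD]
      field_simp
    have h3 : 0 ≤ D⁻¹ * √k := by positivity
    rw [h2] at h1
    rw [mul_div_assoc]
    linarith
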